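/- All maps are smooth; $|\cdot|$ and $(\cdot,\cdot)$ are Euclidean; $(i,j,k)$ denotes a cyclic permutation of $(1,2,3)$. **Surfaces.** Let $g(x,y)$ be an immersed surface in $\mathbb R^3$ in curvature line coordinates, with metric $I=H_1^2dx^2+H_2^2dy^2$ and principal curvatures $\kappa_1,\kappa_2$. A map $\hat g$ is a *Combescure transform* of $g$ if $d\hat g=h_1\,\partial_xg\,dx+h_2\,\partial_yg\,dy$ for functions $h_1,h_2$, which may have zeros (there $\hat g$ degenerates, and the corresponding principal radius is taken to be $0$). Its principal curvatures $\hat\kappa_1,\hat\kappa_2$ are taken with respect to the unit normal of $g$, so that $h_i=\kappa_i/\hat\kappa_i$; where $\kappa_i=0$, the quotient $\kappa_i/\hat\kappa_i$ is understood as $h_i$. A surface is a *G-surface* if in suitable curvature line coordinates (that is, after a reparametrization) it has a Combescure transform $\hat g$, called an *associated surface*, such that $$cH_1^2H_2^2\Big(\frac{\kappa_1}{\hat\kappa_1}-\frac{\kappa_2}{\hat\kappa_2}\Big)^2=H_2^2+\varepsilon H_1^2$$ for some $\varepsilon\in\{0,\pm1\}$ and $c\in\mathbb R\setminus\{0\}$.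 Two Combescure transforms $(\hat g,g^\star)$ of $g$, with factors $h_i$ and $h_i^\star$, form a *dual pair* if $$\frac1{\kappa_1\kappa_2^\star}+\frac1{\kappa_2\kappa_1^\star}=-\frac2{\hat\kappa_1\hat\kappa_2},\qquad\text{understood as } h_1^\star+h_2^\star=-2h_1h_2,$$ and the pair is non-trivial: at every point $\kappa_1\kappa_1^\star\ne-\hat\kappa_1^2$ or $\kappa_2\kappa_2^\star\neq-\hat\kappa_2^2$, understood as $h_1^\star\ne-h_1^2$ or $h_2^\star\ne-h_2^2$. If moreover $\hat g$ is an associated surface of $g$, then $g^\star$ is called the *dual surface* of $g$ with respect to $\hat g$. **Systems.** Let $U\subseteq\mathbb R^3$ be open and connected. A map $f:U\to\mathbb R^3$ is a *triply orthogonal system* if $\det(\partial_1f,\partial_2f,\partial_3f)\ne0$ and $(\partial_if,\partial_jf)=0$ for $i\ne j$. Its Lamé coefficients $H_i$ are defined by $\partial_if=H_iN_i$ with $N_i=\frac{\partial_jf\times\partial_kf}{|\partial_jf\times\partial_kf|}$. It is a *Guichard net* if $H_1^2+H_2^2-H_3^2=0$. A Combescure transform of $f$ is a map $\hat f$ with $d\hat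 f=\sum_ih_i\,\partial_if\,dx_i$ for functions $h_i$, which may have zeros. The system $f$ is a *G-system* if it has Combescure transforms $\hat f$ (an *associated system*) and $f^\star$ (a *dual system*) that restrict to a dual pair on every coordinate surface $x_i=\mathrm{const}$ of $f$. **Theorem.** Let $f:U\to\mathbb R^3$ be a Guichard net, and let $V\subseteq U$ be open and simply connected (for instance $V=U$ if $U$ is simply connected, or a small ball around any given point of $U$). Then: 1. $f|_V$ is a G-system; 2. all coordinate surfaces of $f|_V$ are G-surfaces; 3. for every $p\in V$ there are an associated system $\hat f$ and a dual system $f^\star$ of $f|_V$, forming dual pairs as above and defined on all of $V$, such that the coordinate surfaces of $\hat f$ are associated surfaces of the corresponding coordinate surfaces of $f$, the coordinate surfaces of $f^\star$ are the dual surfaces with respect to these, and $\hat f$ and $f^\star$ are (non-degenerate) triply orthogonal systems in a neighbourhood of $p$. -/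

import Mathlib

open scoped ContDiff

noncomputable section

namespace TriplyOrthogonal

/-- Euclidean three-space, the target of all surfaces and systems. -/
abbrev E3 := EuclideanSpace ℝ (Fin 3)

/-- The Euclidean inner product of two vectors of `ℝ³`. -/
def ip (u v : E3) : ℝ := inner ℝ u v

/-- The cross product on Euclidean three-space. -/
def cross (u v : E3) : E3 := WithLp.toLp 2 (crossProduct (WithLp.ofLp u) (WithLp.ofLp v))

/-- The unit vector `(u × v) / |u × v|`. -/
def unitCross (u v : E3) : E3 := ‖cross u v‖⁻¹ • cross u v

/-- The partial derivative `∂ᵢ f` at `p`. -/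
def pd {n : ℕ} (i : Fin n) (f : (Fin n → ℝ) → E3) (p : Fin n → ℝ) : E3 :=
  fderiv ℝ f p (Pi.single i 1)

/-! ### Surfaces -/

/-- The unit normal of a parametrized surface `g`. -/
def unitNormal (g : (Fin 2 → ℝ) → E3) (p : Fin 2 → ℝ) : E3 := unitCross (pd 0 g p) (pd 1 g p)

/-- The coefficient `H_j² = (∂_j g, ∂_j g)` of the induced metric. -/
def metricCoeff (g : (Fin 2 → ℝ) → E3) (j : Fin 2) (p : Fin 2 → ℝ) : ℝ := ip (pd j g p) (pd j g p)

/-- `g` is a smooth immersed surface parametrized by curvature line coordinates on the open set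
`S`: the coordinates are orthogonal and conjugate. -/
structure IsCurvatureLineParam (g : (Fin 2 → ℝ) → E3) (S : Set (Fin 2 → ℝ)) : Prop where
  isOpen : IsOpen S
  smooth : ContDiffOn ℝ ∞ g S
  immersed : ∀ p ∈ S, LinearIndependent ℝ ![pd 0 g p, pd 1 g p]
  orthogonal : ∀ p ∈ S, ip (pd 0 g p) (pd 1 g p) = 0
  conjugate : ∀ p ∈ S, ip (pd 0 (pd 1 g) p) (unitNormal g p) = 0

/-- The principal curvature in the `j`-th coordinate direction, with respect to the field of unit
normals `n`, of a surface `g` in curvature line coordinates: Rodrigues' equation is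
`∂_j n = -κ_j ∂_j g`. If `∂_j g` vanishes (`g` degenerates), the value is `0`, so that
the radius `1 / κ_j` is `0` as well, which is the convention for degenerate transforms. -/
def principalCurvature (n g : (Fin 2 → ℝ) → E3) (j : Fin 2) (p : Fin 2 → ℝ) : ℝ :=
  -(ip (pd j n p) (pd j g p)) / ip (pd j g p) (pd j g p)

/-- `f'` is a Combescure transform on `U`, with factors `h`, of the map `f`, which is a surface in
curvature line coordinates (`n = 2`) or a triply orthogonal system (`n = 3`):
`df' = ∑ᵢ hᵢ ∂ᵢf dxᵢ`, that is, corresponding tangent directions along the coordinate lines are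
parallel. The factors may have zeros, where `f'` degenerates. -/
structure IsCombescureTransform {n : ℕ} (f f' : (Fin n → ℝ) → E3) (h : Fin n → (Fin n → ℝ) → ℝ)
    (U : Set (Fin n → ℝ)) : Prop where
  smooth : ContDiffOn ℝ ∞ f' U
  factor_smooth : ∀ i, ContDiffOn ℝ ∞ (h i) U
  parallel : ∀ i, ∀ p ∈ U, pd i f' p = h i p • pd i f p

/-- With respect to a common field of normals the factors of a Combescure transform are the
quotients of the principal curvatures of `g` and `g'`. -/
theorem principalCurvature_eq_mul {g g' : (Fin 2 → ℝ) → E3} {h : Fin 2 → (Fin 2 → ℝ) → ℝ}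
    {S : Set (Fin 2 → ℝ)} (H : IsCombescureTransform g g' h S) (n : (Fin 2 → ℝ) → E3)
    (j : Fin 2) {p : Fin 2 → ℝ} (hp : p ∈ S) (h0 : h j p ≠ 0) :
    principalCurvature n g j p = h j p * principalCurvature n g' j p := by
  unfold principalCurvature ip
  rw [H.parallel j p hp, real_inner_smul_right, real_inner_smul_left, real_inner_smul_right]
  by_cases hz : pd j g p = 0
  · simp [hz]
  · have hz' : inner ℝ (pd j g p) (pd j g p) ≠ 0 := inner_self_ne_zero.mpr hz
    generalize (inner ℝ (pd j g p) (pd j g p) : ℝ) = a at hz' ⊢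
    field_simp

/-- The G-condition
`c H₁² H₂² (κ₁/κ̂₁ - κ₂/κ̂₂)² = H₂² + ε H₁²` for a surface `g` in curvature line coordinates and
a Combescure transform `g'` of it with factors `h`. The quotient `κ_j/κ̂_j` is (up to a common
sign depending on the choice of normals) the factor `h_j`, which also gives it its meaning where
principal curvatures vanish; the second clause is the formula in terms of the curvatures
themselves, where those of `g` do not vanish. -/
structure GCondition (g g' : (Fin 2 → ℝ) → E3) (h : Fin 2 → (Fin 2 → ℝ) → ℝ) (c ε : ℝ)
    (S : Set (Fin 2 → ℝ)) : Prop where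
  factors : ∀ p ∈ S, c * metricCoeff g 0 p * metricCoeff g 1 p * (h 0 p - h 1 p) ^ 2
    = metricCoeff g 1 p + ε * metricCoeff g 0 p
  curvatures : ∀ p ∈ S,
    principalCurvature (unitNormal g) g 0 p ≠ 0 → principalCurvature (unitNormal g) g 1 p ≠ 0 →
    c * metricCoeff g 0 p * metricCoeff g 1 p *
      (principalCurvature (unitNormal g) g 0 p / principalCurvature (unitNormal g) g' 0 p
        - principalCurvature (unitNormal g) g 1 p / principalCurvature (unitNormal g) g' 1 p) ^ 2
    = metricCoeff g 1 p + ε * metricCoeff g 0 p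

/-- `g'` is an associated surface of the surface `g` (defined on `S`): in suitable curvature line
coordinates, obtained by a reparametrization `Φ`, it is a Combescure transform satisfying the
G-condition. -/
def IsAssociatedSurface (g g' : (Fin 2 → ℝ) → E3) (S : Set (Fin 2 → ℝ)) : Prop :=
  ∃ Φ : OpenPartialHomeomorph (Fin 2 → ℝ) (Fin 2 → ℝ),
    Φ.target = S ∧ ContDiffOn ℝ ∞ Φ Φ.source ∧ ContDiffOn ℝ ∞ Φ.symm Φ.target ∧
    IsCurvatureLineParam (g ∘ Φ) Φ.source ∧
    ∃ h : Fin 2 → (Fin 2 → ℝ) → ℝ, IsCombescureTransform (g ∘ Φ) (g' ∘ Φ) h Φ.source ∧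
    ∃ ε ∈ ({-1, 0, 1} : Set ℝ), ∃ c : ℝ, c ≠ 0 ∧ GCondition (g ∘ Φ) (g' ∘ Φ) h c ε Φ.source

/-- `g` is a G-surface on `S`. -/
def IsGSurface (g : (Fin 2 → ℝ) → E3) (S : Set (Fin 2 → ℝ)) : Prop :=
  ∃ g' : (Fin 2 → ℝ) → E3, IsAssociatedSurface g g' S

/-- `(g', gs)` is a non-trivial pair of Combescure transforms of the surface `g`, given in
curvature line coordinates on `S`, with
`1/(κ₁κ₂*) + 1/(κ₂κ₁*) = -2/(κ̂₁κ̂₂)`. All curvatures refer to the normal of `g`.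
Multiplied by `κ₁κ₂`, the relation reads `κ₂/κ₂* + κ₁/κ₁* = -2 (κ₁/κ̂₁)(κ₂/κ̂₂)`, where the
quotients are the Combescure factors `h_j = κ_j/κ̂_j` and `hs_j = κ_j/κ_j*` (also where curvatures
vanish). Likewise non-triviality, `κ₁κ₁* ≠ -κ̂₁²` or `κ₂κ₂* ≠ -κ̂₂²`, reads
`hs₁ ≠ -h₁²` or `hs₂ ≠ -h₂²`. -/
def IsDualityPair (g g' gs : (Fin 2 → ℝ) → E3) (S : Set (Fin 2 → ℝ)) : Prop :=
  IsCurvatureLineParam g S ∧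
  ∃ h hs : Fin 2 → (Fin 2 → ℝ) → ℝ,
    IsCombescureTransform g g' h S ∧ IsCombescureTransform g gs hs S ∧
    (∀ p ∈ S, hs 1 p + hs 0 p = -2 * (h 0 p * h 1 p)) ∧
    (∀ p ∈ S,
      principalCurvature (unitNormal g) g 0 p ≠ 0 → principalCurvature (unitNormal g) g 1 p ≠ 0 →
      1 / (principalCurvature (unitNormal g) g 0 p * principalCurvature (unitNormal g) gs 1 p)
        + 1 / (principalCurvature (unitNormal g) g 1 p * principalCurvature (unitNormal g) gs 0 p)
      = -2 / (principalCurvature (unitNormal g) g' 0 p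
          * principalCurvature (unitNormal g) g' 1 p)) ∧
    (∀ p ∈ S, hs 0 p ≠ -(h 0 p) ^ 2 ∨ hs 1 p ≠ -(h 1 p) ^ 2)

/-- `gs` is the dual surface of `g` with respect to the associated surface `g'`. -/
def IsDualSurface (g g' gs : (Fin 2 → ℝ) → E3) (S : Set (Fin 2 → ℝ)) : Prop :=
  IsAssociatedSurface g g' S ∧ IsDualityPair g g' gs S

/-! ### Triply orthogonal systems -/

/-- `f` is a (smooth) triply orthogonal system on the open and connected set `U`. -/
structure IsTriplyOrthogonal (f : (Fin 3 → ℝ) → E3) (U : Set (Fin 3 → ℝ)) : Prop where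
  isOpen : IsOpen U
  isConnected : IsConnected U
  smooth : ContDiffOn ℝ ∞ f U
  det_ne_zero : ∀ p ∈ U, Matrix.det (Matrix.of fun a b : Fin 3 => pd b f p a) ≠ 0
  orthogonal : ∀ p ∈ U, ∀ i j : Fin 3, i ≠ j → ip (pd i f p) (pd j f p) = 0

/-- The unit normal `N_i` of the coordinate surfaces `x_i = const`; the indices are cyclic,
`(i, j, k) = (i, i + 1, i + 2)` modulo `3`. -/
def sysNormal (f : (Fin 3 → ℝ) → E3) (i : Fin 3) (p : Fin 3 → ℝ) : E3 :=
  unitCross (pd (i + 1) f p) (pd (i + 2) f p)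

/-- The Lamé coefficient `H_i`, given by `∂_i f = H_i N_i`. -/
def lame (f : (Fin 3 → ℝ) → E3) (i : Fin 3) (p : Fin 3 → ℝ) : ℝ := ip (pd i f p) (sysNormal f i p)

/-- A Guichard net: a triply orthogonal system with `H₁² + H₂² - H₃² = 0`. -/
def IsGuichardNet (f : (Fin 3 → ℝ) → E3) (U : Set (Fin 3 → ℝ)) : Prop :=
  IsTriplyOrthogonal f U ∧ ∀ p ∈ U, lame f 0 p ^ 2 + lame f 1 p ^ 2 - lame f 2 p ^ 2 = 0

/-- The point with `x_i = c`, `x_{i+1} = u₀`, `x_{i+2} = u₁` (indices modulo `3`). -/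
def slicePoint (i : Fin 3) (c : ℝ) (u : Fin 2 → ℝ) : Fin 3 → ℝ :=
  fun m => if m = i then c else if m = i + 1 then u 0 else u 1

/-- The coordinate surface `x_i = c` of `f`, in the coordinates `(x_{i+1}, x_{i+2})`. -/
def coordSurface (f : (Fin 3 → ℝ) → E3) (i : Fin 3) (c : ℝ) : (Fin 2 → ℝ) → E3 :=
  fun u => f (slicePoint i c u)

/-- The parameter domain of the coordinate surface `x_i = c` of a system on `U`. -/
def coordDomain (U : Set (Fin 3 → ℝ)) (i : Fin 3) (c : ℝ) : Set (Fin 2 → ℝ) :=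
  {u | slicePoint i c u ∈ U}

/-- `f'` and `fs` are an associated system and a dual system of the triply orthogonal system `f`:
Combescure transforms that form, on all coordinate surfaces, non-trivial pairs with
`1/(κ_{ij}κ_{ik}*) + 1/(κ_{ik}κ_{ij}*) = -2/(κ̂_{ij}κ̂_{ik})`. -/
def IsSystemDualityPair (f f' fs : (Fin 3 → ℝ) → E3) (U : Set (Fin 3 → ℝ)) : Prop :=
  (∃ h, IsCombescureTransform f f' h U) ∧ (∃ hs, IsCombescureTransform f fs hs U) ∧
  ∀ i c, IsDualityPair (coordSurface f i c) (coordSurface f' i c) (coordSurface fs i c)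
    (coordDomain U i c)

/-- `f` is a G-system on `U`. -/
def IsGSystem (f : (Fin 3 → ℝ) → E3) (U : Set (Fin 3 → ℝ)) : Prop :=
  IsTriplyOrthogonal f U ∧ ∃ f' fs : (Fin 3 → ℝ) → E3, IsSystemDualityPair f f' fs U

end TriplyOrthogonal

end

open TriplyOrthogonal

open scoped ContDiff
open TriplyOrthogonal

/-! Write `H_i = |∂_i f|` and index by 0, 1, 2. Functions `h_i` are the factors of a Combescure
transform iff `∑ h_i ∂_i f dx_i` is closed; by Dupin's theorem this means `∂_j h_i = (h_j - h_i) ∂_j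
log H_i` for `i ≠ j`.

On a coordinate surface `x_k = const` the Guichard relation turns the right side of the G-condition
into `±H_k^2`, so it suffices that `h_i - h_j = ± H_k / (H_i H_j)`. Dividing `H_0^2 + H_1^2 = H_2^2`
by `H_0 H_1 H_2` shows that suitable signs make these three differences compatible. Once they are
prescribed, the factor equations give the full differential of `h_0`. Lamé's equations and the
differentiated Guichard relation make it closed, and simple connectedness integrates it
(`exists_isGuichardFactorSystem`).

Duality on all three families of surfaces forces `h_i* = h_j h_k - h_i (h_j + h_k)`. These functions
solve the factor equations again (`IsGuichardFactorSystem.dual`), and `h_i* + h_i^2 = (h_i -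
h_j)(h_i - h_k)` never vanishes, which is non-triviality. The `h_i` are free up to a common additive
constant, which serves to make all `h_i` and `h_i*` non-zero at a given point. -/

/-- A copy of a type, carrying the discrete topology. -/
@[ext]
structure DiscreteCopy (G : Type*) where
  /-- The underlying element. -/
  val : G

instance (G : Type*) : TopologicalSpace (DiscreteCopy G) := ⊥

instance (G : Type*) : DiscreteTopology (DiscreteCopy G) := ⟨rfl⟩

/-! ### The Poincaré lemma on simply connected sets, via the covering by germs of primitives -/

section Primitive

variable {E G : Type*} [NormedAddCommGroup E] [NormedSpace ℝ E] [NormedAddCommGroup G]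
  [NormedSpace ℝ G]

/-- Two primitives of the same form differ by a locally constant function. -/
theorem eventually_sub_eq_of_hasFDerivAt {u v : E → G} {η : E → E →L[ℝ] G} {x : E}
    (hu : ∀ᶠ y in nhds x, HasFDerivAt u (η y) y) (hv : ∀ᶠ y in nhds x, HasFDerivAt v (η y) y) :
    ∀ᶠ y in nhds x, u y - v y = u x - v x := by
  obtain ⟨r, hr, H⟩ := Metric.eventually_nhds_iff_ball.mp (hu.and hv)
  filter_upwards [Metric.ball_mem_nhds x hr] with y hy
  have hd : ∀ z ∈ Metric.ball x r, HasFDerivAt (u - v) (0 : E →L[ℝ] G) z := fun z hz => by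
    simpa using (H z hz).1.sub (H z hz).2
  exact (convex_ball x r).is_const_of_fderivWithin_eq_zero (𝕜 := ℝ)
    (fun z hz => (hd z hz).differentiableAt.differentiableWithinAt)
    (fun z hz => by
      rw [fderivWithin_of_isOpen Metric.isOpen_ball hz, (hd z hz).fderiv])
    hy (Metric.mem_ball_self hr)

/-- The bundle of germs of primitives of a form, with local primitives `P x` on `B x`. -/
def primitiveBundleCore {V : Set E} {η : E → E →L[ℝ] G} (B : V → Set E) (P : V → E → G)
    (hB : ∀ x, IsOpen (B x)) (hxB : ∀ x : V, (x : E) ∈ B x)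
    (hP : ∀ x, ∀ y ∈ B x, HasFDerivAt (P x) (η y) y) :
    FiberBundleCore V V (DiscreteCopy G) where
  baseSet x := Subtype.val ⁻¹' B x
  isOpen_baseSet x := (hB x).preimage continuous_subtype_val
  indexAt x := x
  mem_baseSet_at := hxB
  coordChange x y b v := ⟨v.val + (P x b - P y b)⟩
  coordChange_self x b _ v := by simp
  -- The fibre is discrete, so continuity amounts to local constancy, which holds because two
  -- primitives differ by a locally constant function.
  continuousOn_coordChange x y := by
    rintro ⟨b, v⟩ ⟨⟨hbx, hby⟩, -⟩
    refine ContinuousAt.continuousWithinAt ?_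
    refine (continuousAt_const (y := (⟨v.val + (P x b - P y b)⟩ : DiscreteCopy G))).congr ?_
    have h1 := eventually_sub_eq_of_hasFDerivAt
      (Filter.mem_of_superset ((hB x).mem_nhds hbx) (hP x))
      (Filter.mem_of_superset ((hB y).mem_nhds hby) (hP y))
    have h2 : ∀ᶠ q : V × DiscreteCopy G in nhds (b, v), q.2 = v :=
      (continuous_snd.continuousAt (x := (b, v))).eventually_mem
        ((isOpen_discrete {v}).mem_nhds rfl)
    have h3 := (continuous_subtype_val.comp
      (continuous_fst (X := V) (Y := DiscreteCopy G))).continuousAt (x := (b, v)) |>.eventually h1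
    filter_upwards [h2, h3] with q hq hq'
    simp only [Function.comp_apply] at hq'
    rw [hq, hq']
  coordChange_comp x y z b _ v := by
    ext
    change v.val + (P x b - P y b) + (P y b - P z b) = v.val + (P x b - P z b)
    abel

/-- The Poincaré lemma on a simply connected open set. -/
theorem exists_hasFDerivAt_of_isSimplyConnected [CompleteSpace G] {V : Set E} (hVo : IsOpen V)
    (hV : IsSimplyConnected V) {η : E → E →L[ℝ] G} (hη : DifferentiableOn ℝ η V)
    (hsymm : ∀ a ∈ V, ∀ x y, fderiv ℝ η a x y = fderiv ℝ η a y x) :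
    ∃ u : E → G, ∀ x ∈ V, HasFDerivAt u (η x) x := by
  classical
  have := hV.simplyConnectedSpace
  have := hVo.locallyPathConnectedSpace
  have hloc : ∀ x : V, ∃ B : Set E, ∃ P : E → G, IsOpen B ∧ (x : E) ∈ B ∧
      ∀ y ∈ B, HasFDerivAt P (η y) y := fun x => by
    obtain ⟨r, hr, hrV⟩ := Metric.isOpen_iff.mp hVo x x.2
    obtain ⟨P, hP⟩ := (convex_ball (x : E) r).exists_forall_hasFDerivAt_of_fderiv_symmetric
      Metric.isOpen_ball (hη.mono hrV) (fun a ha => hsymm a (hrV ha))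
    exact ⟨_, P, Metric.isOpen_ball, Metric.mem_ball_self hr, hP⟩
  choose B P hB hxB hP using hloc
  let Z := primitiveBundleCore B P hB hxB hP
  obtain ⟨x₀, hx₀⟩ := hV.nonempty
  -- A bundle with discrete fibre is a covering, so the identity of `V` lifts to a global section: a
  -- coherent choice of germs. The initial value `0` is arbitrary.
  obtain ⟨s, ⟨-, hs⟩, -⟩ :=
    (FiberBundle.isCoveringMap (F := DiscreteCopy G) (E := Z.Fiber)).existsUnique_continuousMap_lifts
      (ContinuousMap.id V) ⟨x₀, hx₀⟩ ⟨⟨x₀, hx₀⟩, ⟨0⟩⟩ rfl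
  have hs' : ∀ y : V, (s y).1 = y := fun y => congrFun hs y
  let t : V → G := fun y => DiscreteCopy.val (s y).2
  -- The fibre over `y` is read in the chart with index `y`, so `t y` stands for the germ of `P y +
  -- t y`.
  refine ⟨fun y => if hy : y ∈ V then t ⟨y, hy⟩ + P ⟨y, hy⟩ y else 0, fun x hx => ?_⟩
  let ξ : V := ⟨x, hx⟩
  have hmem : s ξ ∈ (Z.localTriv ξ).source := by
    change ((s ξ).1 : E) ∈ B ξ
    rw [hs']; exact hxB ξ
  have hc : ContinuousAt (fun y => (Z.localTriv ξ (s y)).2) ξ :=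
    continuous_snd.continuousAt.comp
      (((Z.localTriv ξ).continuousOn.continuousAt
        ((Z.localTriv ξ).open_source.mem_nhds hmem)).comp s.continuous.continuousAt)
  have hev : ∀ᶠ y in nhds ξ, (Z.localTriv ξ (s y)).2 = (Z.localTriv ξ (s ξ)).2 :=
    hc.eventually_mem ((isOpen_discrete {(Z.localTriv ξ (s ξ)).2}).mem_nhds rfl)
  have hval : ∀ y, (Z.localTriv ξ (s y)).2.val = t y + (P y y - P ξ y) := fun y => by
    change DiscreteCopy.val (s y).2 + (P (s y).1 (s y).1 - P ξ (s y).1) = _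
    rw [hs']
  -- In the fixed chart `ξ` the section is locally constant, so near `ξ` the glued function is `P ξ`
  -- plus a constant.
  obtain ⟨c, hcst⟩ : ∃ c : G, ∀ᶠ y in nhds ξ, t y + P y y = c + P ξ y := by
    refine ⟨(Z.localTriv ξ (s ξ)).2.val, hev.mono fun y hy => ?_⟩
    rw [← hy, hval]
    abel
  rw [nhds_subtype_eq_comap, Filter.eventually_comap] at hcst
  refine ((hP ξ x (hxB ξ)).const_add c).congr_of_eventuallyEq ?_
  filter_upwards [hcst, hVo.mem_nhds hx] with y hy hyV
  rw [dif_pos hyV]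
  exact hy ⟨y, hyV⟩ rfl

end Primitive

/-! ### Calculus of partial derivatives and closed one-forms in coordinates -/

section PartialDerivatives

variable {n : ℕ} {G : Type*} [NormedAddCommGroup G] [NormedSpace ℝ G]

/-- The partial derivative of a map on `ℝⁿ` with values in a normed space. -/
noncomputable def partialDeriv (i : Fin n) (F : (Fin n → ℝ) → G) (p : Fin n → ℝ) : G :=
  fderiv ℝ F p (Pi.single i 1)

variable {F K : (Fin n → ℝ) → G} {u v : (Fin n → ℝ) → ℝ} {p : Fin n → ℝ} {V : Set (Fin n → ℝ)}

theorem partialDeriv_add (i : Fin n) (hF : DifferentiableAt ℝ F p) (hK : DifferentiableAt ℝ K p) :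
    partialDeriv i (fun q => F q + K q) p = partialDeriv i F p + partialDeriv i K p := by
  unfold partialDeriv
  rw [fderiv_fun_add hF hK]; rfl

theorem partialDeriv_sub (i : Fin n) (hF : DifferentiableAt ℝ F p) (hK : DifferentiableAt ℝ K p) :
    partialDeriv i (fun q => F q - K q) p = partialDeriv i F p - partialDeriv i K p := by
  unfold partialDeriv
  rw [fderiv_fun_sub hF hK]; rfl

theorem partialDeriv_neg (i : Fin n) : partialDeriv i (fun q => -F q) p = -partialDeriv i F p := by
  unfold partialDeriv
  rw [fderiv_fun_neg]; rfl

theorem partialDeriv_smul (i : Fin n) (hu : DifferentiableAt ℝ u p) (hF : DifferentiableAt ℝ F p) :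
    partialDeriv i (fun q => u q • F q) p = u p • partialDeriv i F p + partialDeriv i u p • F p := by
  unfold partialDeriv
  rw [fderiv_fun_smul hu hF]; rfl

theorem partialDeriv_mul (i : Fin n) (hu : DifferentiableAt ℝ u p) (hv : DifferentiableAt ℝ v p) :
    partialDeriv i (fun q => u q * v q) p = u p * partialDeriv i v p + partialDeriv i u p * v p :=
  partialDeriv_smul i hu hv

theorem partialDeriv_exp (i : Fin n) (hu : DifferentiableAt ℝ u p) :
    partialDeriv i (fun q => Real.exp (u q)) p = Real.exp (u p) * partialDeriv i u p := by
  unfold partialDeriv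
  rw [fderiv_exp hu]; rfl

theorem partialDeriv_ip {F K : (Fin n → ℝ) → E3} (i : Fin n) (hF : DifferentiableAt ℝ F p)
    (hK : DifferentiableAt ℝ K p) :
    partialDeriv i (fun q => ip (F q) (K q)) p
      = ip (F p) (partialDeriv i K p) + ip (partialDeriv i F p) (K p) := by
  unfold partialDeriv ip
  rw [fderiv_inner_apply ℝ hF hK]

theorem partialDeriv_congr (hV : IsOpen V) (hFK : ∀ q ∈ V, F q = K q) (i : Fin n) (hp : p ∈ V) :
    partialDeriv i F p = partialDeriv i K p := by
  unfold partialDeriv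
  rw [Filter.EventuallyEq.fderiv_eq (Filter.mem_of_superset (hV.mem_nhds hp) hFK)]

theorem ContDiffOn.partialDeriv (hF : ContDiffOn ℝ ∞ F V) (hV : IsOpen V) (i : Fin n) :
    ContDiffOn ℝ ∞ (partialDeriv i F) V :=
  (((contDiffOn_infty_iff_fderiv_of_isOpen hV).mp hF).2).clm_apply contDiffOn_const

theorem ContDiffOn.differentiableAt_of_isOpen (hF : ContDiffOn ℝ ∞ F V) (hV : IsOpen V)
    (hp : p ∈ V) : DifferentiableAt ℝ F p :=
  (hF.contDiffAt (hV.mem_nhds hp)).differentiableAt (by simp)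

theorem partialDeriv_comm (hF : ContDiffOn ℝ ∞ F V) (hV : IsOpen V) (hp : p ∈ V) (i j : Fin n) :
    partialDeriv i (partialDeriv j F) p = partialDeriv j (partialDeriv i F) p := by
  have hd : DifferentiableAt ℝ (fderiv ℝ F) p :=
    (((contDiffOn_infty_iff_fderiv_of_isOpen hV).mp hF).2).differentiableAt_of_isOpen hV hp
  have key : ∀ k l : Fin n, partialDeriv k (partialDeriv l F) p
      = fderiv ℝ (fderiv ℝ F) p (Pi.single k 1) (Pi.single l 1) := fun k l => by
    change fderiv ℝ (fun q => fderiv ℝ F q (Pi.single l 1)) p (Pi.single k 1) = _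
    rw [fderiv_clm_apply hd (differentiableAt_const _)]
    simp
  rw [key, key]
  have hs : IsSymmSndFDerivAt ℝ F p :=
    (hF.contDiffAt (hV.mem_nhds hp)).isSymmSndFDerivAt (by
      rw [minSmoothness_of_isRCLikeNormedField]; exact ENat.natCast_le_of_coe_top_le_withTop le_rfl 2)
  exact hs _ _

/-- The one-form with the given components. -/
noncomputable def formOfComponents (η : Fin n → (Fin n → ℝ) → G) (p : Fin n → ℝ) :
    (Fin n → ℝ) →L[ℝ] G :=
  ∑ i, (ContinuousLinearMap.proj (R := ℝ) (φ := fun _ : Fin n => ℝ) i).smulRight (η i p)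

theorem formOfComponents_apply (η : Fin n → (Fin n → ℝ) → G) (p x : Fin n → ℝ) :
    formOfComponents η p x = ∑ i, x i • η i p := by
  simp [formOfComponents]

theorem contDiffOn_formOfComponents {η : Fin n → (Fin n → ℝ) → G}
    (hη : ∀ i, ContDiffOn ℝ ∞ (η i) V) : ContDiffOn ℝ ∞ (formOfComponents η) V :=
  ContDiffOn.sum fun i _ => contDiffOn_const.smulRight (hη i)

theorem fderiv_apply_eq_sum_partialDeriv (x : Fin n → ℝ) :
    fderiv ℝ F p x = ∑ i, x i • partialDeriv i F p := by
  conv_lhs => rw [pi_eq_sum_univ' x]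
  rw [map_sum]
  refine Finset.sum_congr rfl fun i _ => ?_
  rw [map_smul]
  unfold partialDeriv
  congr 2

/-- The Poincaré lemma on a simply connected open set, in coordinates. -/
theorem exists_partialDeriv_eq [CompleteSpace G] (hVo : IsOpen V) (hV : IsSimplyConnected V)
    {η : Fin n → (Fin n → ℝ) → G} (hη : ∀ i, ContDiffOn ℝ ∞ (η i) V)
    (hclosed : ∀ i j, ∀ p ∈ V, partialDeriv i (η j) p = partialDeriv j (η i) p) :
    ∃ u : (Fin n → ℝ) → G, ContDiffOn ℝ ∞ u V ∧ ∀ i, ∀ p ∈ V, partialDeriv i u p = η i p := by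
  have hsm := contDiffOn_formOfComponents hη
  obtain ⟨u, hu⟩ := exists_hasFDerivAt_of_isSimplyConnected hVo hV
    (hsm.differentiableOn (by simp)) (by
      intro a ha
      have key : ∀ x y, fderiv ℝ (formOfComponents η) a x y
          = ∑ i, ∑ j, x i • y j • partialDeriv i (η j) a := fun x y => by
        have h1 : fderiv ℝ (formOfComponents η) a x y
            = fderiv ℝ (fun q => formOfComponents η q y) a x := by
          rw [fderiv_clm_apply (hsm.differentiableAt_of_isOpen hVo ha) (differentiableAt_const _)]
          simp
        rw [h1, fderiv_apply_eq_sum_partialDeriv]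
        refine Finset.sum_congr rfl fun i _ => ?_
        rw [← Finset.smul_sum]
        congr 1
        unfold partialDeriv
        simp only [formOfComponents_apply]
        rw [fderiv_fun_sum (A := fun j q => y j • η j q) fun j _ =>
          ((hη j).differentiableAt_of_isOpen hVo ha).const_smul (y j)]
        simp only [sum_apply]
        refine Finset.sum_congr rfl fun j _ => ?_
        rw [fderiv_fun_const_smul ((hη j).differentiableAt_of_isOpen hVo ha)]
        rfl
      intro x y
      rw [key, key, Finset.sum_comm]
      refine Finset.sum_congr rfl fun i _ => Finset.sum_congr rfl fun j _ => ?_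
      rw [hclosed j i a ha, smul_comm])
  refine ⟨u, ?_, fun i p hp => ?_⟩
  · rw [contDiffOn_infty_iff_fderiv_of_isOpen hVo]
    exact ⟨fun p hp => (hu p hp).differentiableAt.differentiableWithinAt,
      hsm.congr fun p hp => (hu p hp).fderiv⟩
  · unfold partialDeriv
    rw [(hu p hp).fderiv, formOfComponents_apply,
      Finset.sum_eq_single i (fun j _ hj => by simp [hj]) (by simp)]
    simp

end PartialDerivatives

/-! ### Euclidean vector algebra -/

/-- Logarithms of the Lamé coefficients of a triply orthogonal system, up to sign:
`log |∂ⱼf|`. -/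
noncomputable def logLame (f : (Fin 3 → ℝ) → E3) (j : Fin 3) (p : Fin 3 → ℝ) : ℝ :=
  (1 / 2) * Real.log (ip (pd j f p) (pd j f p))

theorem ip_comm (u v : E3) : ip u v = ip v u := real_inner_comm _ _

theorem ip_add_left (u v w : E3) : ip (u + v) w = ip u w + ip v w := inner_add_left _ _ _

theorem ip_sub_left (u v w : E3) : ip (u - v) w = ip u w - ip v w := inner_sub_left _ _ _

theorem ip_smul_left (r : ℝ) (u v : E3) : ip (r • u) v = r * ip u v := real_inner_smul_left _ _ _

theorem ip_smul_right (r : ℝ) (u v : E3) : ip u (r • v) = r * ip u v := real_inner_smul_right _ _ _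

theorem ip_eq_sum (u v : E3) : ip u v = u 0 * v 0 + u 1 * v 1 + u 2 * v 2 := by
  simp [ip, PiLp.inner_apply, Fin.sum_univ_three, mul_comm]

theorem cross_coords (u v : E3) : (cross u v) 0 = u 1 * v 2 - u 2 * v 1 ∧
    (cross u v) 1 = u 2 * v 0 - u 0 * v 2 ∧ (cross u v) 2 = u 0 * v 1 - u 1 * v 0 := by
  simp [cross, crossProduct]

theorem ip_cross_left (u v : E3) : ip u (cross u v) = 0 := by
  obtain ⟨h0, h1, h2⟩ := cross_coords u v
  rw [ip_eq_sum, h0, h1, h2]; ring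

theorem ip_cross_right (u v : E3) : ip v (cross u v) = 0 := by
  obtain ⟨h0, h1, h2⟩ := cross_coords u v
  rw [ip_eq_sum, h0, h1, h2]; ring

theorem ip_cross_self (u v : E3) :
    ip (cross u v) (cross u v) = ip u u * ip v v - ip u v ^ 2 := by
  obtain ⟨h0, h1, h2⟩ := cross_coords u v
  simp only [ip_eq_sum, h0, h1, h2]; ring

/-- The left side is a squared determinant, hence the Gram determinant of the three vectors. -/
theorem ip_cross_sq (u v w : E3) :
    ip w (cross u v) ^ 2 = ip w w * (ip u u * ip v v - ip u v ^ 2)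
      + 2 * ip u v * ip v w * ip u w - ip u u * ip v w ^ 2 - ip v v * ip u w ^ 2 := by
  obtain ⟨h0, h1, h2⟩ := cross_coords u v
  simp only [ip_eq_sum, h0, h1, h2]; ring

theorem ip_unitCross_sq {u v w : E3} (huv : ip u v = 0) (hvw : ip v w = 0) (huw : ip u w = 0)
    (hu : ip u u ≠ 0) (hv : ip v v ≠ 0) : ip w (unitCross u v) ^ 2 = ip w w := by
  have hn : ‖cross u v‖ ^ 2 = ip u u * ip v v := by
    have := ip_cross_self u v
    rw [huv] at this
    rw [← real_inner_self_eq_norm_sq]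
    simpa [ip] using this
  have h := ip_cross_sq u v w
  rw [huv, hvw, huw] at h
  rw [unitCross, ip_smul_right, mul_pow, h, inv_pow, hn]
  field_simp
  ring

theorem ip_unitCross_of_span {u v : E3} (a b : ℝ) : ip (a • u + b • v) (unitCross u v) = 0 := by
  rw [unitCross, ip_smul_right, ip_add_left, ip_smul_left, ip_smul_left, ip_cross_left,
    ip_cross_right]
  ring

/-! ### Dupin's theorem and Lamé's equations -/

namespace TriplyOrthogonal.IsTriplyOrthogonal

variable {f : (Fin 3 → ℝ) → E3} {U : Set (Fin 3 → ℝ)} {p : Fin 3 → ℝ}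

theorem contDiffOn_pd (hf : IsTriplyOrthogonal f U) (i : Fin 3) : ContDiffOn ℝ ∞ (pd i f) U :=
  hf.smooth.partialDeriv hf.isOpen i

theorem differentiableAt_pd (hf : IsTriplyOrthogonal f U) (i : Fin 3) (hp : p ∈ U) :
    DifferentiableAt ℝ (pd i f) p :=
  (hf.contDiffOn_pd i).differentiableAt_of_isOpen hf.isOpen hp

theorem eq_zero_of_ip (hf : IsTriplyOrthogonal f U) (hp : p ∈ U) {v : E3}
    (hv : ∀ i, ip v (pd i f p) = 0) : v = 0 := by
  have h := Matrix.eq_zero_of_vecMul_eq_zero (hf.det_ne_zero p hp) (v := fun a => v a) (by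
    ext b
    have := hv b
    rw [ip_eq_sum] at this
    simpa [Matrix.vecMul, dotProduct, Fin.sum_univ_three] using this)
  ext a
  exact congrFun h a

theorem pd_ne_zero (hf : IsTriplyOrthogonal f U) (hp : p ∈ U) (i : Fin 3) : pd i f p ≠ 0 :=
  fun h => hf.det_ne_zero p hp (Matrix.det_eq_zero_of_column_eq_zero i fun a => by simp [h])

theorem ip_self_pos (hf : IsTriplyOrthogonal f U) (hp : p ∈ U) (i : Fin 3) :
    0 < ip (pd i f p) (pd i f p) :=
  real_inner_self_pos.mpr (hf.pd_ne_zero hp i)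

theorem exp_logLame (hf : IsTriplyOrthogonal f U) (hp : p ∈ U) (i : Fin 3) :
    Real.exp (2 * logLame f i p) = ip (pd i f p) (pd i f p) := by
  rw [logLame, ← mul_assoc, mul_one_div_cancel two_ne_zero, one_mul,
    Real.exp_log (hf.ip_self_pos hp i)]

theorem contDiffOn_logLame (hf : IsTriplyOrthogonal f U) (i : Fin 3) :
    ContDiffOn ℝ ∞ (logLame f i) U :=
  contDiffOn_const.mul (((hf.contDiffOn_pd i).inner ℝ (hf.contDiffOn_pd i)).log
    fun _ hp => (hf.ip_self_pos hp i).ne')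

/-- The Guichard condition involves only squares, so the signs of the Lamé coefficients can be
dropped and `logLame` suffices. -/
theorem lame_sq (hf : IsTriplyOrthogonal f U) (hp : p ∈ U) (i : Fin 3) :
    lame f i p ^ 2 = ip (pd i f p) (pd i f p) :=
  ip_unitCross_sq (hf.orthogonal p hp _ _ (by revert i; decide))
    (hf.orthogonal p hp _ _ (by revert i; decide)) (hf.orthogonal p hp _ _ (by revert i; decide))
    (hf.ip_self_pos hp _).ne' (hf.ip_self_pos hp _).ne'

theorem ip_partialDeriv_self (hf : IsTriplyOrthogonal f U) (hp : p ∈ U) (i j : Fin 3) :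
    ip (partialDeriv i (pd j f) p) (pd j f p)
      = partialDeriv i (logLame f j) p * ip (pd j f p) (pd j f p) := by
  have h1 : partialDeriv i (fun q => Real.exp (2 * logLame f j q)) p
      = partialDeriv i (fun q => ip (pd j f q) (pd j f q)) p :=
    partialDeriv_congr hf.isOpen (fun q hq => hf.exp_logLame hq j) i hp
  have hd := (hf.contDiffOn_logLame j).differentiableAt_of_isOpen hf.isOpen hp
  rw [partialDeriv_exp i (hd.const_mul 2), partialDeriv_mul i (differentiableAt_const _) hd,
    partialDeriv_ip i (hf.differentiableAt_pd j hp) (hf.differentiableAt_pd j hp),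
    hf.exp_logLame hp, ip_comm (pd j f p) (partialDeriv i (pd j f) p)] at h1
  have h2 : partialDeriv i (fun _ : Fin 3 → ℝ => (2 : ℝ)) p = 0 := by simp [partialDeriv]
  rw [h2] at h1
  linarith

theorem partialDeriv_pd_comm (hf : IsTriplyOrthogonal f U) (hp : p ∈ U) (i j : Fin 3) :
    partialDeriv i (pd j f) p = partialDeriv j (pd i f) p :=
  partialDeriv_comm hf.smooth hf.isOpen hp i j

/-- Dupin's theorem. -/
theorem ip_partialDeriv_pd_eq_zero (hf : IsTriplyOrthogonal f U) (hp : p ∈ U) {i j k : Fin 3}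
    (hij : i ≠ j) (hjk : j ≠ k) (hik : i ≠ k) : ip (partialDeriv i (pd j f) p) (pd k f p) = 0 := by
  -- `(∂_a ∂_b f, ∂_c f)` is antisymmetric in `b, c` by differentiated orthogonality and symmetric
  -- in `a, b`; for distinct indices the two together force it to vanish.
  have anti : ∀ a b c : Fin 3, b ≠ c → ip (partialDeriv a (pd b f) p) (pd c f p)
      = -ip (partialDeriv a (pd c f) p) (pd b f p) := fun a b c hbc => by
    have h : partialDeriv a (fun q => ip (pd b f q) (pd c f q)) p
        = partialDeriv a (fun _ => (0 : ℝ)) p :=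
      partialDeriv_congr hf.isOpen (fun q hq => hf.orthogonal q hq b c hbc) a hp
    rw [partialDeriv_ip a (hf.differentiableAt_pd b hp) (hf.differentiableAt_pd c hp),
      ip_comm (pd b f p)] at h
    have h0 : partialDeriv a (fun _ : Fin 3 → ℝ => (0 : ℝ)) p = 0 := by simp [partialDeriv]
    linarith
  have h1 := anti i j k hjk
  have h2 := anti k i j hij
  have h3 := anti j k i hik.symm
  rw [hf.partialDeriv_pd_comm hp k i, hf.partialDeriv_pd_comm hp k j] at h2
  rw [hf.partialDeriv_pd_comm hp j i] at h3
  linarith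

/-- Both sides have the same inner products with the orthogonal frame: two come from differentiating
the lengths, the third vanishes by Dupin's theorem. -/
theorem partialDeriv_pd (hf : IsTriplyOrthogonal f U) (hp : p ∈ U) {i j : Fin 3} (hij : i ≠ j) :
    partialDeriv i (pd j f) p = partialDeriv i (logLame f j) p • pd j f p
      + partialDeriv j (logLame f i) p • pd i f p := by
  rw [← sub_eq_zero]
  refine hf.eq_zero_of_ip hp fun k => ?_
  rw [ip_sub_left, ip_add_left, ip_smul_left, ip_smul_left]
  by_cases hk : k = j
  · subst hk
    rw [hf.ip_partialDeriv_self hp, hf.orthogonal p hp i k hij]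
    ring
  · by_cases hk' : k = i
    · subst hk'
      rw [hf.partialDeriv_pd_comm hp, hf.ip_partialDeriv_self hp, hf.orthogonal p hp j k hij.symm]
      ring
    · rw [hf.ip_partialDeriv_pd_eq_zero hp hij (Ne.symm hk) (Ne.symm hk'),
        hf.orthogonal p hp _ _ (Ne.symm hk), hf.orthogonal p hp _ _ (Ne.symm hk')]
      ring

theorem contDiffOn_rotation (hf : IsTriplyOrthogonal f U) (i j : Fin 3) :
    ContDiffOn ℝ ∞ (partialDeriv i (logLame f j)) U :=
  (hf.contDiffOn_logLame j).partialDeriv hf.isOpen i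

/-- The second partial derivatives of a tangent field of a triply orthogonal system. -/
theorem partialDeriv_partialDeriv_pd (hf : IsTriplyOrthogonal f U) (hp : p ∈ U) {i j k : Fin 3}
    (hij : i ≠ j) (hkj : k ≠ j) (hki : k ≠ i) :
    partialDeriv k (partialDeriv i (pd j f)) p
      = partialDeriv i (logLame f j) p • (partialDeriv k (logLame f j) p • pd j f p
          + partialDeriv j (logLame f k) p • pd k f p)
        + partialDeriv k (partialDeriv i (logLame f j)) p • pd j f p
        + (partialDeriv j (logLame f i) p • (partialDeriv k (logLame f i) p • pd i f p
          + partialDeriv i (logLame f k) p • pd k f p)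
        + partialDeriv k (partialDeriv j (logLame f i)) p • pd i f p) := by
  have hb := fun a b => (hf.contDiffOn_rotation a b).differentiableAt_of_isOpen hf.isOpen hp
  have hX := fun a => hf.differentiableAt_pd a hp
  rw [partialDeriv_congr hf.isOpen (fun q hq => hf.partialDeriv_pd hq hij) k hp,
    partialDeriv_add k ((hb i j).fun_smul (hX j)) ((hb j i).fun_smul (hX i)),
    partialDeriv_smul k (hb i j) (hX j), partialDeriv_smul k (hb j i) (hX i),
    hf.partialDeriv_pd hp hkj, hf.partialDeriv_pd hp hki]

/-- Lamé's equations for the logarithms of the Lamé coefficients. -/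
theorem lame_equation (hf : IsTriplyOrthogonal f U) (hp : p ∈ U) {i j k : Fin 3}
    (hij : i ≠ j) (hkj : k ≠ j) (hki : k ≠ i) :
    partialDeriv k (partialDeriv i (logLame f j)) p
      = partialDeriv k (logLame f i) p * partialDeriv i (logLame f j) p
        + partialDeriv i (logLame f k) p * partialDeriv k (logLame f j) p
        - partialDeriv i (logLame f j) p * partialDeriv k (logLame f j) p := by
  -- The equation is the `∂_j f` component of `∂_k ∂_j (∂_i f) = ∂_j ∂_k (∂_i f)`.
  have h := partialDeriv_comm (hf.contDiffOn_pd i) hf.isOpen hp k j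
  rw [hf.partialDeriv_partialDeriv_pd hp hij.symm hki hkj,
    hf.partialDeriv_partialDeriv_pd hp hki hij.symm hkj.symm] at h
  have h2 := congrArg (fun v => ip v (pd j f p)) h
  simp only [ip_add_left, ip_smul_left, hf.orthogonal p hp i j hij,
    hf.orthogonal p hp k j hkj] at h2
  have hE := (hf.ip_self_pos hp j).ne'
  refine mul_right_cancel₀ hE ?_
  linear_combination h2

end TriplyOrthogonal.IsTriplyOrthogonal

/-! ### Combescure factors of a system and their duals -/

namespace TriplyOrthogonal

/-- The factors `h` satisfy the equations of a Combescure transform of `f`. -/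
structure IsFactorSystem (f : (Fin 3 → ℝ) → E3) (h : Fin 3 → (Fin 3 → ℝ) → ℝ)
    (V : Set (Fin 3 → ℝ)) : Prop where
  smooth : ∀ i, ContDiffOn ℝ ∞ (h i) V
  partialDeriv_eq : ∀ i j, i ≠ j → ∀ p ∈ V,
    partialDeriv j (h i) p = (h j p - h i p) * partialDeriv j (logLame f i) p

theorem IsFactorSystem.exists_combescure {f : (Fin 3 → ℝ) → E3} {h : Fin 3 → (Fin 3 → ℝ) → ℝ}
    {V : Set (Fin 3 → ℝ)} (H : IsFactorSystem f h V) (hf : IsTriplyOrthogonal f V)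
    (hV : IsSimplyConnected V) : ∃ f' : (Fin 3 → ℝ) → E3, IsCombescureTransform f f' h V := by
  obtain ⟨f', hs, hd⟩ := exists_partialDeriv_eq (η := fun i p => h i p • pd i f p) hf.isOpen hV
    (fun i => (H.smooth i).smul (hf.contDiffOn_pd i)) (fun i j p hp => by
      have hh := fun a => (H.smooth a).differentiableAt_of_isOpen hf.isOpen hp
      have hX := fun a => hf.differentiableAt_pd a hp
      rcases eq_or_ne i j with rfl | hij
      · rfl
      rw [partialDeriv_smul i (hh j) (hX j), partialDeriv_smul j (hh i) (hX i),
        H.partialDeriv_eq j i hij.symm p hp, H.partialDeriv_eq i j hij p hp,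
        hf.partialDeriv_pd hp hij, hf.partialDeriv_pd hp hij.symm]
      module)
  exact ⟨f', hs, H.smooth, hd⟩

/-- Factors of a Combescure transform whose differences are
`hᵢ - hⱼ = ± Hₖ / (Hᵢ Hⱼ)`. -/
structure IsGuichardFactorSystem (f : (Fin 3 → ℝ) → E3) (h : Fin 3 → (Fin 3 → ℝ) → ℝ)
    (V : Set (Fin 3 → ℝ)) : Prop extends IsFactorSystem f h V where
  sub_eq : ∀ i j k, i ≠ j → j ≠ k → i ≠ k → ∃ s : ℝ, s ^ 2 = 1 ∧ ∀ p ∈ V,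
    h i p - h j p = s * Real.exp (logLame f k p - logLame f i p - logLame f j p)

variable {f : (Fin 3 → ℝ) → E3} {h : Fin 3 → (Fin 3 → ℝ) → ℝ} {V : Set (Fin 3 → ℝ)}
  {p : Fin 3 → ℝ}

theorem partialDeriv_add_const (u : (Fin 3 → ℝ) → ℝ) (c : ℝ) (i : Fin 3) :
    partialDeriv i (fun q => u q + c) p = partialDeriv i u p := by
  unfold partialDeriv
  rw [fderiv_add_const]

/-- Only differences and derivatives of the factors enter. On the transforms the shift adds `c • f`,
up to translation. -/
theorem IsGuichardFactorSystem.add_const (H : IsGuichardFactorSystem f h V) (c : ℝ) :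
    IsGuichardFactorSystem f (fun i q => h i q + c) V where
  smooth i := (H.smooth i).add contDiffOn_const
  partialDeriv_eq i j hij p hp := by
    rw [partialDeriv_add_const, H.partialDeriv_eq i j hij p hp]; ring
  sub_eq i j k hij hjk hik := by
    obtain ⟨s, hs, h⟩ := H.sub_eq i j k hij hjk hik
    exact ⟨s, hs, fun p hp => by rw [← h p hp]; ring⟩

theorem IsGuichardFactorSystem.sub_ne_zero (H : IsGuichardFactorSystem f h V) (hp : p ∈ V)
    {i j : Fin 3} (hij : i ≠ j) : h i p - h j p ≠ 0 := by
  obtain ⟨k, hjk, hik⟩ : ∃ k, j ≠ k ∧ i ≠ k := by revert i j; decide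
  obtain ⟨s, hs, h⟩ := H.sub_eq i j k hij hjk hik
  rw [h p hp]
  exact mul_ne_zero (fun h0 => by simp [h0] at hs) (Real.exp_pos _).ne'

theorem IsGuichardFactorSystem.mul_sub_sq (H : IsGuichardFactorSystem f h V)
    (hf : IsTriplyOrthogonal f V) (hp : p ∈ V) {i j k : Fin 3} (hij : i ≠ j) (hjk : j ≠ k)
    (hik : i ≠ k) :
    ip (pd i f p) (pd i f p) * ip (pd j f p) (pd j f p) * (h i p - h j p) ^ 2
      = ip (pd k f p) (pd k f p) := by
  obtain ⟨s, hs, h⟩ := H.sub_eq i j k hij hjk hik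
  rw [h p hp, mul_pow, hs, one_mul, ← hf.exp_logLame hp, ← hf.exp_logLame hp,
    ← hf.exp_logLame hp, ← Real.exp_nat_mul, ← Real.exp_add, ← Real.exp_add]
  congr 1
  push_cast
  ring

theorem IsTriplyOrthogonal.partialDeriv_exp_logLame (hf : IsTriplyOrthogonal f V) (hp : p ∈ V)
    (i j k m : Fin 3) :
    partialDeriv m (fun q => Real.exp (logLame f k q - logLame f i q - logLame f j q)) p
      = Real.exp (logLame f k p - logLame f i p - logLame f j p)
        * (partialDeriv m (logLame f k) p - partialDeriv m (logLame f i) p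
          - partialDeriv m (logLame f j) p) := by
  have hd := fun a => (hf.contDiffOn_logLame a).differentiableAt_of_isOpen hf.isOpen hp
  rw [partialDeriv_exp m (((hd k).fun_sub (hd i)).fun_sub (hd j)),
    partialDeriv_sub m ((hd k).fun_sub (hd i)) (hd j), partialDeriv_sub m (hd k) (hd i)]

theorem IsTriplyOrthogonal.contDiffOn_exp_logLame (hf : IsTriplyOrthogonal f V) (i j k : Fin 3) :
    ContDiffOn ℝ ∞ (fun q => Real.exp (logLame f k q - logLame f i q - logLame f j q)) V :=
  (((hf.contDiffOn_logLame k).sub (hf.contDiffOn_logLame i)).sub (hf.contDiffOn_logLame j)).exp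

/-- The factor equations leave `∂_i h_i` open. It comes from differentiating the prescribed `h_i -
h_j`, since `∂_i h_j` is known. -/
theorem IsGuichardFactorSystem.partialDeriv_self (H : IsGuichardFactorSystem f h V)
    (hf : IsTriplyOrthogonal f V) (hp : p ∈ V) {i j k : Fin 3} (hij : i ≠ j) (hjk : j ≠ k)
    (hik : i ≠ k) :
    partialDeriv i (h i) p
      = (h i p - h j p) * (partialDeriv i (logLame f k) p - partialDeriv i (logLame f i) p) := by
  have hh := fun a => (H.smooth a).differentiableAt_of_isOpen hf.isOpen hp
  obtain ⟨s, hs, h'⟩ := H.sub_eq i j k hij hjk hik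
  have h1 := partialDeriv_congr hf.isOpen h' i hp
  have h2 : partialDeriv i (fun _ : Fin 3 → ℝ => s) p = 0 := by simp [partialDeriv]
  rw [partialDeriv_sub i (hh i) (hh j), partialDeriv_mul i (differentiableAt_const s)
    ((hf.contDiffOn_exp_logLame i j k).differentiableAt_of_isOpen hf.isOpen hp), h2,
    hf.partialDeriv_exp_logLame hp, H.partialDeriv_eq j i hij.symm p hp] at h1
  have h3 := h' p hp
  linear_combination h1 - (partialDeriv i (logLame f k) p - partialDeriv i (logLame f i) p
    - partialDeriv i (logLame f j) p) * h3

/-- Exchanging `j` and `k` gives two formulas for `∂_i h_i`; this combination eliminates `∂_i log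
H_i`. -/
theorem IsGuichardFactorSystem.partialDeriv_self_mul (H : IsGuichardFactorSystem f h V)
    (hf : IsTriplyOrthogonal f V) (hp : p ∈ V) {i j k : Fin 3} (hij : i ≠ j) (hjk : j ≠ k)
    (hik : i ≠ k) :
    partialDeriv i (h i) p * (h j p - h k p) = (h i p - h j p) * (h i p - h k p)
      * (partialDeriv i (logLame f k) p - partialDeriv i (logLame f j) p) := by
  have h1 := H.partialDeriv_self hf hp hij hjk hik
  have h2 := H.partialDeriv_self hf hp hik hjk.symm hij
  linear_combination (h i p - h k p) * h1 - (h i p - h j p) * h2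

/-- The factors of the dual system. -/
def dualFactor (h : Fin 3 → (Fin 3 → ℝ) → ℝ) (i : Fin 3) (p : Fin 3 → ℝ) : ℝ :=
  h (i + 1) p * h (i + 2) p - h i p * (h (i + 1) p + h (i + 2) p)

theorem dualFactor_eq (h : Fin 3 → (Fin 3 → ℝ) → ℝ) {i j k : Fin 3} (hij : i ≠ j) (hjk : j ≠ k)
    (hik : i ≠ k) (p : Fin 3 → ℝ) :
    dualFactor h i p = h j p * h k p - h i p * (h j p + h k p) := by
  have : (j = i + 1 ∧ k = i + 2) ∨ (j = i + 2 ∧ k = i + 1) := by revert i j k; decide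
  rcases this with ⟨rfl, rfl⟩ | ⟨rfl, rfl⟩
  · rfl
  · rw [dualFactor]; ring

theorem dualFactor_add_dualFactor (h : Fin 3 → (Fin 3 → ℝ) → ℝ) {i j : Fin 3} (hij : i ≠ j)
    (p : Fin 3 → ℝ) : dualFactor h i p + dualFactor h j p = -2 * (h i p * h j p) := by
  obtain ⟨k, hjk, hik⟩ : ∃ k, j ≠ k ∧ i ≠ k := by revert i j; decide
  rw [dualFactor_eq h hij hjk hik, dualFactor_eq h hij.symm hik hjk]
  ring

/-- `h_i* + h_i^2` factors as `(h_i - h_j)(h_i - h_k)`. -/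
theorem IsGuichardFactorSystem.dualFactor_ne (H : IsGuichardFactorSystem f h V) (hp : p ∈ V)
    (i : Fin 3) : dualFactor h i p ≠ -(h i p) ^ 2 := fun h0 => by
  have h1 := H.sub_ne_zero hp ((by decide : ∀ i : Fin 3, i ≠ i + 1) i)
  have h2 := H.sub_ne_zero hp ((by decide : ∀ i : Fin 3, i ≠ i + 2) i)
  refine mul_ne_zero h1 h2 ?_
  rw [dualFactor] at h0
  linear_combination h0

/-- In `∂_j h_i*` the only derivative not given by the factor equations is `∂_j h_j`, with
coefficient `h_k - h_i`; `partialDeriv_self_mul` supplies exactly this product. -/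
theorem IsGuichardFactorSystem.dual (H : IsGuichardFactorSystem f h V)
    (hf : IsTriplyOrthogonal f V) : IsFactorSystem f (dualFactor h) V where
  smooth i := ((H.smooth _).mul (H.smooth _)).sub
    ((H.smooth _).mul ((H.smooth _).add (H.smooth _)))
  partialDeriv_eq i j hij p hp := by
    obtain ⟨k, hjk, hik⟩ : ∃ k, j ≠ k ∧ i ≠ k := by revert i j; decide
    have hh := fun a => (H.smooth a).differentiableAt_of_isOpen hf.isOpen hp
    rw [show dualFactor h i = fun q => h j q * h k q - h i q * (h j q + h k q) from
        funext fun q => dualFactor_eq h hij hjk hik q,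
      dualFactor_eq h hij.symm hik hjk,
      partialDeriv_sub j ((hh j).fun_mul (hh k)) ((hh i).fun_mul ((hh j).fun_add (hh k))),
      partialDeriv_mul j (hh j) (hh k), partialDeriv_mul j (hh i) ((hh j).fun_add (hh k)),
      partialDeriv_add j (hh j) (hh k), H.partialDeriv_eq i j hij p hp,
      H.partialDeriv_eq k j hjk.symm p hp]
    have h1 := H.partialDeriv_self_mul hf hp hij.symm hik hjk
    linear_combination (-1) * h1

/-! ### Existence of the factors for a Guichard net -/

/-- A Guichard net on a simply connected set admits factors with `hᵢ - hⱼ = ± Hₖ / (Hᵢ Hⱼ)`. -/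
theorem IsTriplyOrthogonal.exists_isGuichardFactorSystem (hf : IsTriplyOrthogonal f V)
    (hV : IsSimplyConnected V)
    (hG : ∀ p ∈ V, ip (pd 0 f p) (pd 0 f p) + ip (pd 1 f p) (pd 1 f p)
      = ip (pd 2 f p) (pd 2 f p)) : ∃ h, IsGuichardFactorSystem f h V := by
  let b : Fin 3 → Fin 3 → (Fin 3 → ℝ) → ℝ := fun i j => partialDeriv i (logLame f j)
  let a : Fin 3 → (Fin 3 → ℝ) → ℝ := fun k q =>
    Real.exp (logLame f k q - logLame f (k + 1) q - logLame f (k + 2) q)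
  have ha_smooth : ∀ k, ContDiffOn ℝ ∞ (a k) V := fun k => hf.contDiffOn_exp_logLame _ _ _
  have had : ∀ k, ∀ p ∈ V, DifferentiableAt ℝ (a k) p := fun k p hp =>
    (ha_smooth k).differentiableAt_of_isOpen hf.isOpen hp
  have hbd : ∀ i j, ∀ p ∈ V, DifferentiableAt ℝ (b i j) p := fun i j p hp =>
    (hf.contDiffOn_rotation i j).differentiableAt_of_isOpen hf.isOpen hp
  have ha : ∀ m k, ∀ p ∈ V, partialDeriv m (a k) p
      = a k p * (b m k p - b m (k + 1) p - b m (k + 2) p) := fun m k p hp =>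
    hf.partialDeriv_exp_logLame hp _ _ _ _
  -- The Guichard relation divided by `H_0 H_1 H_2`.
  have hsum : ∀ p ∈ V, a 0 p + a 1 p = a 2 p := fun p hp => by
    have h := hG p hp
    rw [← hf.exp_logLame hp, ← hf.exp_logLame hp, ← hf.exp_logLame hp] at h
    have key : ∀ k, a k p = Real.exp (-(logLame f 0 p + logLame f 1 p + logLame f 2 p))
        * Real.exp (2 * logLame f k p) := fun k => by
      rw [← Real.exp_add]
      refine congrArg Real.exp ?_
      fin_cases k <;> simp <;> ring
    rw [key, key, key, ← h]; ring
  -- The differentiated Guichard relation, with `H_0^2` replaced by `H_2^2 - H_1^2`.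
  have hK : ∀ i, ∀ p ∈ V, a 2 p * (b i 2 p - b i 0 p) = -(a 1 p) * (b i 0 p - b i 1 p) :=
    fun i p hp => by
      have h := partialDeriv_congr hf.isOpen hsum i hp
      rw [partialDeriv_add i (had 0 p hp) (had 1 p hp), ha i 0 p hp, ha i 1 p hp, ha i 2 p hp] at h
      have h0 := hsum p hp
      simp only [Fin.reduceAdd, zero_add] at h
      linear_combination (-1 / 2) * h + (1 / 2) * (b i 0 p - b i 1 p - b i 2 p) * h0
  have hbsymm : ∀ i k j, ∀ p ∈ V, partialDeriv k (b i j) p = partialDeriv i (b k j) p :=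
    fun i k j p hp => partialDeriv_comm (hf.contDiffOn_logLame j) hf.isOpen hp k i
  have hlame : ∀ i j k, i ≠ j → k ≠ j → k ≠ i → ∀ p ∈ V, partialDeriv k (b i j) p
      = b k i p * b i j p + b i k p * b k j p - b i j p * b k j p :=
    fun i j k hij hkj hki p hp => hf.lame_equation hp hij hkj hki
  -- The differential of `u = h_0` when `h_0 - h_1 = a 2` and `h_0 - h_2 = a 1`. Components 1 and 2
  -- are the equations for `h_0`; component 0 is the equation for `∂_0 h_1`, with `h_1 = u - a 2`.
  let η : Fin 3 → (Fin 3 → ℝ) → ℝ := ![fun q => a 2 q * (b 0 2 q - b 0 0 q),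
    fun q => -(a 2 q * b 1 0 q), fun q => -(a 1 q * b 2 0 q)]
  have h01 : ∀ p ∈ V, partialDeriv 0 (η 1) p = partialDeriv 1 (η 0) p := fun p hp => by
    change partialDeriv 0 (fun q => -(a 2 q * b 1 0 q)) p
      = partialDeriv 1 (fun q => a 2 q * (b 0 2 q - b 0 0 q)) p
    rw [partialDeriv_neg, partialDeriv_mul 0 (had 2 p hp) (hbd 1 0 p hp),
      partialDeriv_mul 1 (had 2 p hp) ((hbd 0 2 p hp).fun_sub (hbd 0 0 p hp)),
      partialDeriv_sub 1 (hbd 0 2 p hp) (hbd 0 0 p hp), ha 0 2 p hp, ha 1 2 p hp,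
      hlame 0 2 1 (by decide) (by decide) (by decide) p hp, hbsymm 0 1 0 p hp]
    have K0 := hK 0 p hp
    have K1 := hK 1 p hp
    simp only [Fin.reduceAdd]
    linear_combination (b 0 0 p - b 0 1 p) * K1 - (b 1 0 p - b 1 1 p) * K0
  have h02 : ∀ p ∈ V, partialDeriv 0 (η 2) p = partialDeriv 2 (η 0) p := fun p hp => by
    change partialDeriv 0 (fun q => -(a 1 q * b 2 0 q)) p
      = partialDeriv 2 (fun q => a 2 q * (b 0 2 q - b 0 0 q)) p
    -- By `hK`, component 0 can also be written as if obtained from `h_2`; this brings in Lamé's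
    -- equation for `log H_1`, and the second derivatives of `log H_0` cancel.
    rw [partialDeriv_congr hf.isOpen
        (K := fun q => -(a 1 q * (b 0 0 q - b 0 1 q))) (fun q hq => by rw [hK 0 q hq]; ring) 2 hp,
      partialDeriv_neg, partialDeriv_neg, partialDeriv_mul 0 (had 1 p hp) (hbd 2 0 p hp),
      partialDeriv_mul 2 (had 1 p hp) ((hbd 0 0 p hp).fun_sub (hbd 0 1 p hp)),
      partialDeriv_sub 2 (hbd 0 0 p hp) (hbd 0 1 p hp), ha 0 1 p hp, ha 2 1 p hp,
      hlame 0 1 2 (by decide) (by decide) (by decide) p hp, hbsymm 0 2 0 p hp]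
    have K0 := hK 0 p hp
    have K2 := hK 2 p hp
    simp only [Fin.reduceAdd]
    linear_combination (b 2 0 p - b 2 2 p) * K0 - (b 0 0 p - b 0 2 p) * K2
  have h12 : ∀ p ∈ V, partialDeriv 1 (η 2) p = partialDeriv 2 (η 1) p := fun p hp => by
    change partialDeriv 1 (fun q => -(a 1 q * b 2 0 q)) p
      = partialDeriv 2 (fun q => -(a 2 q * b 1 0 q)) p
    rw [partialDeriv_neg, partialDeriv_neg, partialDeriv_mul 1 (had 1 p hp) (hbd 2 0 p hp),
      partialDeriv_mul 2 (had 2 p hp) (hbd 1 0 p hp), ha 1 1 p hp, ha 2 2 p hp,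
      hlame 2 0 1 (by decide) (by decide) (by decide) p hp,
      hlame 1 0 2 (by decide) (by decide) (by decide) p hp]
    have K1 := hK 1 p hp
    have K2 := hK 2 p hp
    simp only [Fin.reduceAdd]
    linear_combination b 2 0 p * K1 + b 1 0 p * K2
  have hη : ∀ i, ContDiffOn ℝ ∞ (η i) V := by
    have hb := hf.contDiffOn_rotation
    intro i
    fin_cases i
    · exact (ha_smooth 2).mul ((hb 0 2).sub (hb 0 0))
    · exact ((ha_smooth 2).mul (hb 1 0)).neg
    · exact ((ha_smooth 1).mul (hb 2 0)).neg
  obtain ⟨u, hu, hdu⟩ := exists_partialDeriv_eq hf.isOpen hV hη (fun i j p hp => by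
    fin_cases i <;> fin_cases j
    exacts [rfl, h01 p hp, h02 p hp, (h01 p hp).symm, rfl, h12 p hp, (h02 p hp).symm,
      (h12 p hp).symm, rfl])
  have hud : ∀ p ∈ V, DifferentiableAt ℝ u p := fun p hp =>
    hu.differentiableAt_of_isOpen hf.isOpen hp
  have e0 : ∀ p ∈ V, partialDeriv 0 u p = a 2 p * (b 0 2 p - b 0 0 p) := hdu 0
  have e1 : ∀ p ∈ V, partialDeriv 1 u p = -(a 2 p * b 1 0 p) := hdu 1
  have e2 : ∀ p ∈ V, partialDeriv 2 u p = -(a 1 p * b 2 0 p) := hdu 2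
  let h : Fin 3 → (Fin 3 → ℝ) → ℝ := ![u, fun q => u q - a 2 q, fun q => u q - a 1 q]
  refine ⟨h, ⟨?_, ?_⟩, ?_⟩
  · intro i
    fin_cases i
    exacts [hu, hu.sub (ha_smooth 2), hu.sub (ha_smooth 1)]
  · have d1 : ∀ j, ∀ p ∈ V, partialDeriv j (h 1) p
        = partialDeriv j u p - a 2 p * (b j 2 p - b j 0 p - b j 1 p) := fun j p hp => by
      change partialDeriv j (fun q => u q - a 2 q) p = _
      rw [partialDeriv_sub j (hud p hp) (had 2 p hp), ha j 2 p hp]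
      rfl
    have d2 : ∀ j, ∀ p ∈ V, partialDeriv j (h 2) p
        = partialDeriv j u p - a 1 p * (b j 1 p - b j 2 p - b j 0 p) := fun j p hp => by
      change partialDeriv j (fun q => u q - a 1 q) p = _
      rw [partialDeriv_sub j (hud p hp) (had 1 p hp), ha j 1 p hp]
      rfl
    -- The equations for `∂_1 h_0`, `∂_2 h_0` and `∂_0 h_1` are built into `η`; the other three need
    -- `hK`.
    intro i j hij p hp
    have K0 := hK 0 p hp
    have K1 := hK 1 p hp
    have K2 := hK 2 p hp
    change _ = (h j p - h i p) * b j i p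
    fin_cases i <;> fin_cases j
    · exact absurd rfl hij
    · change partialDeriv 1 u p = (u p - a 2 p - u p) * b 1 0 p
      rw [e1 p hp]; ring
    · change partialDeriv 2 u p = (u p - a 1 p - u p) * b 2 0 p
      rw [e2 p hp]; ring
    · refine (d1 0 p hp).trans ?_
      change _ = (u p - (u p - a 2 p)) * b 0 1 p
      rw [e0 p hp]; ring
    · exact absurd rfl hij
    · refine (d1 2 p hp).trans ?_
      change _ = (u p - a 1 p - (u p - a 2 p)) * b 2 1 p
      rw [e2 p hp]; linear_combination (-1) * K2
    · refine (d2 0 p hp).trans ?_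
      change _ = (u p - (u p - a 1 p)) * b 0 2 p
      rw [e0 p hp]; linear_combination K0
    · refine (d2 1 p hp).trans ?_
      change _ = (u p - a 2 p - (u p - a 1 p)) * b 1 2 p
      rw [e1 p hp]; linear_combination K1
    · exact absurd rfl hij
  · have s01 : ∀ p ∈ V, h 0 p - h 1 p = a 2 p := fun p _ => by
      change u p - (u p - a 2 p) = _; ring
    have s02 : ∀ p ∈ V, h 0 p - h 2 p = a 1 p := fun p _ => by
      change u p - (u p - a 1 p) = _; ring
    have s12 : ∀ p ∈ V, h 1 p - h 2 p = -a 0 p := fun p hp => by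
      change u p - a 2 p - (u p - a 1 p) = _
      linear_combination hsum p hp
    have ha' : ∀ i j k, i ≠ j → j ≠ k → i ≠ k → ∀ p,
        Real.exp (logLame f k p - logLame f i p - logLame f j p) = a k p :=
      fun i j k hij hjk hik p => by
        have : (i = k + 1 ∧ j = k + 2) ∨ (i = k + 2 ∧ j = k + 1) := by revert i j k; decide
        rcases this with ⟨rfl, rfl⟩ | ⟨rfl, rfl⟩
        · rfl
        · exact congrArg Real.exp (by ring)
    intro i j k hij hjk hik
    simp only [ha' i j k hij hjk hik]
    fin_cases i <;> fin_cases j <;> fin_cases k <;>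
      first
      | exact absurd rfl hij
      | exact absurd rfl hjk
      | exact absurd rfl hik
      | skip
    · exact ⟨1, by norm_num, fun p hp => (s01 p hp).trans (one_mul _).symm⟩
    · exact ⟨1, by norm_num, fun p hp => (s02 p hp).trans (one_mul _).symm⟩
    · exact ⟨-1, by norm_num, fun p hp => by
        change h 1 p - h 0 p = -1 * a 2 p
        linear_combination (-1) * s01 p hp⟩
    · exact ⟨-1, by norm_num, fun p hp => (s12 p hp).trans (neg_one_mul _).symm⟩
    · exact ⟨-1, by norm_num, fun p hp => by
        change h 2 p - h 0 p = -1 * a 1 p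
        linear_combination (-1) * s02 p hp⟩
    · exact ⟨1, by norm_num, fun p hp => by
        change h 2 p - h 1 p = 1 * a 0 p
        linear_combination (-1) * s12 p hp⟩

end TriplyOrthogonal

namespace TriplyOrthogonal

/-! ### Restriction to coordinate surfaces -/

section Slices

/-- The index of the coordinate `uⱼ` on a coordinate surface `xᵢ = const`. -/
def sliceIndex (i : Fin 3) : Fin 2 → Fin 3 := ![i + 1, i + 2]

/-- The linear part of `slicePoint`. -/
noncomputable def sliceLinear (i : Fin 3) : (Fin 2 → ℝ) →L[ℝ] (Fin 3 → ℝ) :=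
  ContinuousLinearMap.pi fun m =>
    if m = i then 0 else if m = i + 1 then ContinuousLinearMap.proj 0
      else ContinuousLinearMap.proj 1

theorem sliceIndex_zero_ne_one : ∀ i, sliceIndex i 0 ≠ sliceIndex i 1 := by decide

theorem sliceIndex_ne_self : ∀ i j, sliceIndex i j ≠ i := by decide

theorem sliceIndex_injective : ∀ i, Function.Injective (sliceIndex i) := by decide

theorem slicePoint_eq (i : Fin 3) (c : ℝ) :
    slicePoint i c = fun u => Pi.single i c + sliceLinear i u := by
  funext u m
  by_cases h1 : m = i
  · subst h1
    simp [slicePoint, sliceLinear]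
  · by_cases h2 : m = i + 1
    · subst h2
      simp [slicePoint, sliceLinear]
    · simp [slicePoint, sliceLinear, h1, h2]

theorem contDiff_slicePoint (i : Fin 3) (c : ℝ) : ContDiff ℝ ∞ (slicePoint i c) := by
  rw [slicePoint_eq]
  exact contDiff_const.add (sliceLinear i).contDiff

theorem sliceLinear_single (i : Fin 3) (j : Fin 2) :
    sliceLinear i (Pi.single j 1) = Pi.single (sliceIndex i j) 1 := by
  ext m
  fin_cases i <;> fin_cases j <;> fin_cases m <;> simp [sliceLinear, sliceIndex]

theorem partialDeriv_comp_slicePoint {G : Type*} [NormedAddCommGroup G] [NormedSpace ℝ G]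
    {F : (Fin 3 → ℝ) → G} {i : Fin 3} {c : ℝ} {u : Fin 2 → ℝ}
    (hF : DifferentiableAt ℝ F (slicePoint i c u)) (j : Fin 2) :
    partialDeriv j (fun v => F (slicePoint i c v)) u
      = partialDeriv (sliceIndex i j) F (slicePoint i c u) := by
  have hs : HasFDerivAt (slicePoint i c) (sliceLinear i) u := by
    rw [slicePoint_eq]
    exact (sliceLinear i).hasFDerivAt.const_add _
  unfold partialDeriv
  have hc : HasFDerivAt (fun v => F (slicePoint i c v)) _ u := hF.hasFDerivAt.comp u hs
  rw [hc.fderiv, ← sliceLinear_single]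
  rfl

variable {f f' : (Fin 3 → ℝ) → E3} {h : Fin 3 → (Fin 3 → ℝ) → ℝ} {V : Set (Fin 3 → ℝ)}

theorem isOpen_coordDomain (hV : IsOpen V) (i : Fin 3) (c : ℝ) : IsOpen (coordDomain V i c) :=
  hV.preimage (contDiff_slicePoint i c).continuous

theorem contDiffOn_comp_slicePoint {G : Type*} [NormedAddCommGroup G] [NormedSpace ℝ G]
    {F : (Fin 3 → ℝ) → G} (hF : ContDiffOn ℝ ∞ F V) (i : Fin 3) (c : ℝ) :
    ContDiffOn ℝ ∞ (fun u => F (slicePoint i c u)) (coordDomain V i c) :=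
  hF.comp (contDiff_slicePoint i c).contDiffOn fun _ hu => hu

theorem pd_coordSurface (hV : IsOpen V) (hf : ContDiffOn ℝ ∞ f V) (i : Fin 3) (c : ℝ) (j : Fin 2)
    {u : Fin 2 → ℝ} (hu : u ∈ coordDomain V i c) :
    pd j (coordSurface f i c) u = pd (sliceIndex i j) f (slicePoint i c u) :=
  partialDeriv_comp_slicePoint (hf.differentiableAt_of_isOpen hV hu) j

theorem IsCombescureTransform.coordSurface (H : IsCombescureTransform f f' h V) (hV : IsOpen V)
    (hf : ContDiffOn ℝ ∞ f V) (i : Fin 3) (c : ℝ) :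
    IsCombescureTransform (coordSurface f i c) (coordSurface f' i c)
      (fun j u => h (sliceIndex i j) (slicePoint i c u)) (coordDomain V i c) where
  smooth := contDiffOn_comp_slicePoint H.smooth i c
  factor_smooth j := contDiffOn_comp_slicePoint (H.factor_smooth _) i c
  parallel j u hu := by
    rw [pd_coordSurface hV H.smooth i c j hu, pd_coordSurface hV hf i c j hu,
      H.parallel _ _ hu]

theorem IsTriplyOrthogonal.isCurvatureLineParam_coordSurface (hf : IsTriplyOrthogonal f V)
    (i : Fin 3) (c : ℝ) : IsCurvatureLineParam (coordSurface f i c) (coordDomain V i c) where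
  isOpen := isOpen_coordDomain hf.isOpen i c
  smooth := contDiffOn_comp_slicePoint hf.smooth i c
  immersed u hu := by
    have ho : LinearIndependent ℝ fun j => pd j f (slicePoint i c u) :=
      linearIndependent_of_ne_zero_of_inner_eq_zero (hf.pd_ne_zero hu)
        fun a b hab => hf.orthogonal _ hu a b hab
    convert ho.comp (sliceIndex i) (sliceIndex_injective i) using 1
    funext j
    fin_cases j
    exacts [pd_coordSurface hf.isOpen hf.smooth i c 0 hu,
      pd_coordSurface hf.isOpen hf.smooth i c 1 hu]
  orthogonal u hu := by
    rw [pd_coordSurface hf.isOpen hf.smooth i c 0 hu, pd_coordSurface hf.isOpen hf.smooth i c 1 hu]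
    exact hf.orthogonal _ hu _ _ (sliceIndex_zero_ne_one i)
  -- By `partialDeriv_pd` the mixed derivative is tangent to the surface.
  conjugate u hu := by
    have h1 : pd 0 (pd 1 (coordSurface f i c)) u
        = partialDeriv (sliceIndex i 0) (pd (sliceIndex i 1) f) (slicePoint i c u) :=
      (partialDeriv_congr (isOpen_coordDomain hf.isOpen i c)
        (fun v hv => pd_coordSurface hf.isOpen hf.smooth i c 1 hv) 0 hu).trans
        (partialDeriv_comp_slicePoint (hf.differentiableAt_pd _ hu) 0)
    rw [h1, unitNormal, pd_coordSurface hf.isOpen hf.smooth i c 0 hu,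
      pd_coordSurface hf.isOpen hf.smooth i c 1 hu,
      hf.partialDeriv_pd hu (sliceIndex_zero_ne_one i), add_comm]
    exact ip_unitCross_of_span _ _

end Slices

/-! ### From factors to principal curvatures -/

section Curvatures

variable {g g' gs : (Fin 2 → ℝ) → E3} {h hs : Fin 2 → (Fin 2 → ℝ) → ℝ} {S : Set (Fin 2 → ℝ)}

/-- The factors of a Combescure transform are the quotients of the principal curvatures. -/
theorem IsCombescureTransform.principalCurvature_div (H : IsCombescureTransform g g' h S)
    (n : (Fin 2 → ℝ) → E3) (j : Fin 2) {p : Fin 2 → ℝ} (hp : p ∈ S)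
    (hκ : principalCurvature n g j p ≠ 0) :
    principalCurvature n g j p / principalCurvature n g' j p = h j p := by
  by_cases h0 : h j p = 0
  -- Where the transform degenerates its curvature is `0` by convention, and division by zero
  -- returns `0 = h j p`.
  · have : principalCurvature n g' j p = 0 := by
      simp [principalCurvature, ip, H.parallel j p hp, h0]
    rw [this, h0, div_zero]
  · have h1 := principalCurvature_eq_mul H n j hp h0
    rw [div_eq_iff (fun h2 => hκ (by rw [h1, h2, mul_zero])), h1]

theorem IsCombescureTransform.gCondition (H : IsCombescureTransform g g' h S) {c ε : ℝ}
    (hG : ∀ p ∈ S, c * metricCoeff g 0 p * metricCoeff g 1 p * (h 0 p - h 1 p) ^ 2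
      = metricCoeff g 1 p + ε * metricCoeff g 0 p) : GCondition g g' h c ε S where
  factors := hG
  curvatures p hp h0 h1 := by
    rw [H.principalCurvature_div _ 0 hp h0, H.principalCurvature_div _ 1 hp h1, hG p hp]

theorem IsCurvatureLineParam.isAssociatedSurface (hg : IsCurvatureLineParam g S)
    (H : IsCombescureTransform g g' h S) {c ε : ℝ} (hε : ε ∈ ({-1, 0, 1} : Set ℝ)) (hc : c ≠ 0)
    (hG : ∀ p ∈ S, c * metricCoeff g 0 p * metricCoeff g 1 p * (h 0 p - h 1 p) ^ 2
      = metricCoeff g 1 p + ε * metricCoeff g 0 p) : IsAssociatedSurface g g' S :=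
  ⟨OpenPartialHomeomorph.ofSet S hg.isOpen, rfl, contDiffOn_id, contDiffOn_id, hg, h, H, ε, hε, c,
    hc, H.gCondition hG⟩

theorem IsCurvatureLineParam.isDualityPair (hg : IsCurvatureLineParam g S)
    (H : IsCombescureTransform g g' h S) (Hs : IsCombescureTransform g gs hs S)
    (hd : ∀ p ∈ S, hs 1 p + hs 0 p = -2 * (h 0 p * h 1 p))
    (hn : ∀ p ∈ S, hs 0 p ≠ -(h 0 p) ^ 2 ∨ hs 1 p ≠ -(h 1 p) ^ 2) : IsDualityPair g g' gs S := by
  refine ⟨hg, h, hs, H, Hs, hd, fun p hp h0 h1 => ?_, hn⟩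
  have e := H.principalCurvature_div (unitNormal g)
  have es := Hs.principalCurvature_div (unitNormal g)
  -- Valid also for `κ' = 0`, so degenerate points need no separate case.
  have inv_eq : ∀ {κ κ' r : ℝ}, κ ≠ 0 → κ / κ' = r → κ'⁻¹ = r / κ := fun {κ κ' r} hκ h => by
    rw [← h]; field_simp
  rw [one_div, one_div, mul_inv, mul_inv, div_eq_mul_inv (-2 : ℝ), mul_inv,
    inv_eq h0 (e 0 hp h0), inv_eq h1 (e 1 hp h1), inv_eq h0 (es 0 hp h0), inv_eq h1 (es 1 hp h1)]
  field_simp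
  linear_combination hd p hp

end Curvatures

/-! ### Associated and dual surfaces, and non-degeneracy -/

variable {f f' fs : (Fin 3 → ℝ) → E3} {h : Fin 3 → (Fin 3 → ℝ) → ℝ} {V : Set (Fin 3 → ℝ)}

theorem IsGuichardFactorSystem.isDualityPair_coordSurface (H : IsGuichardFactorSystem f h V)
    (hf : IsTriplyOrthogonal f V) (hf' : IsCombescureTransform f f' h V)
    (hfs : IsCombescureTransform f fs (dualFactor h) V) (i : Fin 3) (c : ℝ) :
    IsDualityPair (coordSurface f i c) (coordSurface f' i c) (coordSurface fs i c)
      (coordDomain V i c) :=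
  (hf.isCurvatureLineParam_coordSurface i c).isDualityPair
    (hf'.coordSurface hf.isOpen hf.smooth i c) (hfs.coordSurface hf.isOpen hf.smooth i c)
    (fun u _ => by
      rw [add_comm]
      exact dualFactor_add_dualFactor h (sliceIndex_zero_ne_one i) _)
    (fun _ hu => Or.inl (H.dualFactor_ne hu _))

theorem IsGuichardFactorSystem.isAssociatedSurface_coordSurface (H : IsGuichardFactorSystem f h V)
    (hf : IsTriplyOrthogonal f V) (hf' : IsCombescureTransform f f' h V)
    (hG : ∀ p ∈ V, ip (pd 0 f p) (pd 0 f p) + ip (pd 1 f p) (pd 1 f p)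
      = ip (pd 2 f p) (pd 2 f p)) (i : Fin 3) (c : ℝ) :
    IsAssociatedSurface (coordSurface f i c) (coordSurface f' i c) (coordDomain V i c) := by
  have hc := hf'.coordSurface hf.isOpen hf.smooth i c
  have hg := hf.isCurvatureLineParam_coordSurface i c
  have hm : ∀ j, ∀ u ∈ coordDomain V i c, metricCoeff (coordSurface f i c) j u
      = ip (pd (sliceIndex i j) f (slicePoint i c u)) (pd (sliceIndex i j) f (slicePoint i c u)) :=
    fun j u hu => by rw [metricCoeff, pd_coordSurface hf.isOpen hf.smooth i c j hu]
  have hsq : ∀ u ∈ coordDomain V i c, metricCoeff (coordSurface f i c) 0 u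
      * metricCoeff (coordSurface f i c) 1 u
      * (h (sliceIndex i 0) (slicePoint i c u) - h (sliceIndex i 1) (slicePoint i c u)) ^ 2
      = ip (pd i f (slicePoint i c u)) (pd i f (slicePoint i c u)) := fun u hu => by
    rw [hm 0 u hu, hm 1 u hu]
    exact H.mul_sub_sq hf hu (sliceIndex_zero_ne_one i) (sliceIndex_ne_self i 1)
      (sliceIndex_ne_self i 0)
  let E : Fin 3 → (Fin 3 → ℝ) → ℝ := fun m q => ip (pd m f q) (pd m f q)
  have hE : ∀ q ∈ V, E 0 q + E 1 q = E 2 q := hG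
  -- The left side is `c H_i^2`, and the surface coordinates are `(x_{i+1}, x_{i+2})`; solving the
  -- Guichard relation for `H_i^2` yields `c` and `ε`. For `i = 1` the order `(x_2, x_0)` forces `c
  -- = -1`.
  fin_cases i
  · refine hg.isAssociatedSurface hc (ε := -1) (c := 1) (by simp) one_ne_zero fun u hu => ?_
    rw [one_mul, hsq u hu, hm 0 u hu, hm 1 u hu]
    change E 0 _ = E 2 _ + -1 * E 1 _
    linarith [hE _ hu]
  · refine hg.isAssociatedSurface hc (ε := -1) (c := -1) (by simp) (by norm_num) fun u hu => ?_
    rw [mul_assoc (-1 : ℝ), mul_assoc (-1 : ℝ), hsq u hu, hm 0 u hu, hm 1 u hu]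
    change -1 * E 1 _ = E 0 _ + -1 * E 2 _
    linarith [hE _ hu]
  · refine hg.isAssociatedSurface hc (ε := 1) (c := 1) (by simp) one_ne_zero fun u hu => ?_
    rw [one_mul, hsq u hu, hm 0 u hu, hm 1 u hu]
    change E 2 _ = E 1 _ + E 0 _
    linarith [hE _ hu]

theorem IsTriplyOrthogonal.mono {W : Set (Fin 3 → ℝ)} (hf : IsTriplyOrthogonal f V) (hWV : W ⊆ V)
    (hWo : IsOpen W) (hW : IsConnected W) : IsTriplyOrthogonal f W where
  isOpen := hWo
  isConnected := hW
  smooth := hf.smooth.mono hWV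
  det_ne_zero p hp := hf.det_ne_zero p (hWV hp)
  orthogonal p hp := hf.orthogonal p (hWV hp)

theorem IsCombescureTransform.isTriplyOrthogonal (H : IsCombescureTransform f f' h V)
    (hf : IsTriplyOrthogonal f V) {W : Set (Fin 3 → ℝ)} (hWV : W ⊆ V) (hWo : IsOpen W)
    (hW : IsConnected W) (hne : ∀ i, ∀ p ∈ W, h i p ≠ 0) : IsTriplyOrthogonal f' W where
  isOpen := hWo
  isConnected := hW
  smooth := H.smooth.mono hWV
  det_ne_zero p hp := by
    have : (Matrix.of fun a b : Fin 3 => pd b f' p a)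
        = Matrix.of fun a b : Fin 3 => h b p * (Matrix.of fun a b : Fin 3 => pd b f p a) a b := by
      ext a b
      simp [H.parallel b p (hWV hp)]
    rw [this, Matrix.det_mul_row]
    exact mul_ne_zero (Finset.prod_ne_zero_iff.mpr fun i _ => hne i p hp)
      (hf.det_ne_zero p (hWV hp))
  orthogonal p hp i j hij := by
    rw [H.parallel i p (hWV hp), H.parallel j p (hWV hp), ip_smul_left, ip_smul_right,
      hf.orthogonal p (hWV hp) i j hij]
    ring

/-- A suitable common shift makes three numbers and their dual factors non-zero. -/
theorem exists_add_ne_zero (x : Fin 3 → ℝ) : ∃ c : ℝ, ∀ i : Fin 3, x i + c ≠ 0 ∧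
    (x (i + 1) + c) * (x (i + 2) + c) - (x i + c) * ((x (i + 1) + c) + (x (i + 2) + c)) ≠ 0 := by
  open Polynomial in
  -- The product of the two quantities for index `i` as a polynomial in the shift, up to sign: the
  -- shifted dual factor is minus the monic quadratic. A non-zero polynomial has a non-root in the
  -- infinite field.
  let P : Fin 3 → ℝ[X] := fun i => (X + C (x i)) * (X ^ 2 + C (2 * x i) * X
    + C (x i * (x (i + 1) + x (i + 2)) - x (i + 1) * x (i + 2)))
  have hP : ∏ i, P i ≠ 0 := Finset.prod_ne_zero_iff.mpr fun i _ =>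
    mul_ne_zero (Polynomial.X_add_C_ne_zero _) (by
      refine Polynomial.Monic.ne_zero ?_
      monicity!)
  obtain ⟨c, hc⟩ := (∏ i, P i).exists_eval_ne_zero_of_natDegree_lt_card hP
    (by rw [Cardinal.mk_real]; exact (Cardinal.natCast_lt_aleph0).trans Cardinal.aleph0_lt_continuum)
  rw [Polynomial.eval_prod, Finset.prod_ne_zero_iff] at hc
  refine ⟨c, fun i => ?_⟩
  have hi := hc i (Finset.mem_univ i)
  simp only [P, Polynomial.eval_mul, Polynomial.eval_add, Polynomial.eval_X, Polynomial.eval_C,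
    Polynomial.eval_pow] at hi
  refine ⟨fun h => hi ?_, fun h => hi ?_⟩
  · rw [add_comm c, h, zero_mul]
  · linear_combination (-(c + x i)) * h

end TriplyOrthogonal

/-! ### The main theorem -/

theorem mainTheorem1 (f : (Fin 3 → ℝ) → E3) (U : Set (Fin 3 → ℝ)) (hf : IsGuichardNet f U)
    (V : Set (Fin 3 → ℝ)) (hVU : V ⊆ U) (hVo : IsOpen V) (hV : IsSimplyConnected V) :
    IsGSystem f V ∧
    (∀ i c, IsGSurface (coordSurface f i c) (coordDomain V i c)) ∧
    (∀ p ∈ V, ∃ f' fs : (Fin 3 → ℝ) → E3,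
      IsSystemDualityPair f f' fs V ∧
      (∀ i c, IsAssociatedSurface (coordSurface f i c) (coordSurface f' i c) (coordDomain V i c) ∧
        IsDualSurface (coordSurface f i c) (coordSurface f' i c) (coordSurface fs i c)
          (coordDomain V i c)) ∧
      ∃ W : Set (Fin 3 → ℝ), p ∈ W ∧ W ⊆ V ∧
        IsTriplyOrthogonal f' W ∧ IsTriplyOrthogonal fs W) := by
  have hfV : IsTriplyOrthogonal f V := hf.1.mono hVU hVo hV.isPathConnected.isConnected
  have hG : ∀ p ∈ V, ip (pd 0 f p) (pd 0 f p) + ip (pd 1 f p) (pd 1 f p)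
      = ip (pd 2 f p) (pd 2 f p) := fun p hp => by
    have h := hf.2 p (hVU hp)
    rw [hfV.lame_sq hp, hfV.lame_sq hp, hfV.lame_sq hp] at h
    linarith
  obtain ⟨h, hh⟩ := hfV.exists_isGuichardFactorSystem hV hG
  have main : ∀ p ∈ V, ∃ f' fs : (Fin 3 → ℝ) → E3, IsSystemDualityPair f f' fs V ∧
      (∀ i c, IsAssociatedSurface (coordSurface f i c) (coordSurface f' i c) (coordDomain V i c) ∧
        IsDualSurface (coordSurface f i c) (coordSurface f' i c) (coordSurface fs i c)
          (coordDomain V i c)) ∧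
      ∃ W : Set (Fin 3 → ℝ), p ∈ W ∧ W ⊆ V ∧
        IsTriplyOrthogonal f' W ∧ IsTriplyOrthogonal fs W := fun p hp => by
    -- The shift depends on `p`, yet the shifted factors live on all of `V`; only non-degeneracy is
    -- restricted to a ball around `p`.
    obtain ⟨c, hc⟩ := exists_add_ne_zero fun i => h i p
    have H := hh.add_const c
    set k : Fin 3 → (Fin 3 → ℝ) → ℝ := fun i q => h i q + c
    have Hd := H.dual hfV
    obtain ⟨f', hf'⟩ := H.exists_combescure hfV hV
    obtain ⟨fs, hfs⟩ := Hd.exists_combescure hfV hV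
    have hdual := H.isDualityPair_coordSurface hfV hf' hfs
    have hassoc := H.isAssociatedSurface_coordSurface hfV hf' hG
    refine ⟨f', fs, ⟨⟨k, hf'⟩, ⟨_, hfs⟩, hdual⟩, fun i c => ⟨hassoc i c, hassoc i c, hdual i c⟩, ?_⟩
    have hev : ∀ᶠ q in nhds p, q ∈ V ∧ ∀ i, k i q ≠ 0 ∧ dualFactor k i q ≠ 0 :=
      (hVo.eventually_mem hp).and (Filter.eventually_all.mpr fun i =>
        Filter.Eventually.and
          (((H.smooth i).continuousOn.continuousAt (hVo.mem_nhds hp)).eventually_ne (hc i).1)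
          (((Hd.smooth i).continuousOn.continuousAt (hVo.mem_nhds hp)).eventually_ne (hc i).2))
    obtain ⟨r, hr, hW⟩ := Metric.eventually_nhds_iff_ball.mp hev
    have hconn : IsConnected (Metric.ball p r) :=
      ((convex_ball p r).isPathConnected ⟨p, Metric.mem_ball_self hr⟩).isConnected
    exact ⟨Metric.ball p r, Metric.mem_ball_self hr, fun q hq => (hW q hq).1,
      hf'.isTriplyOrthogonal hfV (fun q hq => (hW q hq).1) Metric.isOpen_ball hconn
        fun i q hq => ((hW q hq).2 i).1,
      hfs.isTriplyOrthogonal hfV (fun q hq => (hW q hq).1) Metric.isOpen_ball hconn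
        fun i q hq => ((hW q hq).2 i).2⟩
  -- The first two claims need no non-degeneracy, so the pair found for any one point serves.
  obtain ⟨p, hp⟩ := hV.nonempty
  obtain ⟨f', fs, h1, h2, -⟩ := main p hp
  exact ⟨⟨hfV, f', fs, h1⟩, fun i c => ⟨_, (h2 i c).1⟩, main⟩
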